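/- A residuated lattice is an algebra $\langle A,\wedge,\vee,\cdot,\to,\bot,\top\rangle$ such that $\langle A,\wedge,\vee,\bot,\top\rangle$ is a bounded lattice, $\langle A,\cdot,\top\rangle$ is a commutative monoid, and $a\cdot b\le c\iff a\le b\to c$. It is a BL-algebra if $x\wedge y=x\cdot(x\to y)$ and $(x\to y)\vee(y\to x)=\top$ hold identically; a BL-chain is a totally ordered BL-algebra. Put $\neg x:=x\to\bot$, $x^0:=\top$, $x^{n+1}:=x^n\cdot x$. A nucleus on a residuated lattice is a closure operator $\gamma$ with $\gamma(a)\cdot\gamma(b)\le\gamma(a\cdot b)$ for all $a,b$. A unary term $t(x)$ is a nucleus on a variety $\mathcal V$ of BL-algebras if its interpretation $t^{\mathbf A}$ is a nucleus on $\mathbf A$ for every $\mathbf A\in\mathcal V$. Every nontrivial BL-chain $\mathbf A$ is an ordinal sum $\mathbf A=(\bigoplus_{i\in I}\mathbf A_i)^+$, where $I$ is a totally ordered set with first element $0$, the $\mathbf A_i$ (the components) are nontrivial totally ordered Wajsberg hoops with $A_i\cap A_j=\{\top\}$ for $i\ne j$, and $\bot\in A_0$. That is, $A=\bigcup_i A_i$,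 each $A_i$ contains $\top$, is closed under $\cdot$ and $\to$, and satisfies $(x\to y)\to y=(y\to x)\to x$; and, for $i<j$ and $y\in A_j$, one has $x\cdot y=x$ and $x\to y=\top$ if $x\in A_i\setminus\{\top\}$, and $y\to x=x$ if $x\in A_i$. Let $I_b$ be the set of $i\in I$ such that $\mathbf A_i$ has a first element, and $I_u:=I\setminus I_b$. **Theorem.** Let $\mathcal V$ be a variety of BL-algebras, let $m\ge 1$ be an integer, and let $$s_m(x):=\neg\neg x\wedge\bigl((x^m\to x^{m+1})\to x\bigr),\qquad t_m(x):=\neg\neg x\wedge(x^m\to x^{m+1}).$$ (1) $s_m(x)$ is a nucleus on $\mathcal V$ if and only if, for every nontrivial BL-chain $\mathbf A=(\bigoplus_{i\in I}\mathbf A_i)^+$ in $\mathcal V$: $i<j$ for all $i\in I_b\setminus\{0\}$ and $j\in I_u$; and $a^m=a^{m+1}$ for all $a\in A_i$ with $i\in I_b\setminus\{0\}$. (2) $t_m(x)$ is a nucleus on $\mathcal V$ if and only if, for every nontrivial BL-chain $\mathbf A=(\bigoplus_{i\in I}\mathbf A_i)^+$ in $\mathcal V$: $i<j$ for all $i\in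 I_u$ and $j\in I_b\setminus\{0\}$; and $a^m=a^{m+1}$ for all $a\in A_i$ with $i\in I_b\setminus\{0\}$. -/

import Mathlib

universe u

namespace BLNuclei

/-- A (bounded, commutative, integral) residuated lattice `⟨A, ∧, ∨, ·, →, ⊥, ⊤⟩`. The implication
is written `⇨`; the unit `1` of the monoid is the top element. -/
class ResiduatedLattice (A : Type u) extends Lattice A, BoundedOrder A, CommMonoid A, HImp A where
  one_eq_top : (1 : A) = ⊤
  mul_le_iff_le_himp : ∀ a b c : A, a * b ≤ c ↔ a ≤ b ⇨ c

/-- A BL-algebra: a divisible and prelinear residuated lattice. -/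
class BLAlgebra (A : Type u) extends ResiduatedLattice A where
  inf_eq_mul_himp : ∀ a b : A, a ⊓ b = a * (a ⇨ b)
  himp_sup_himp : ∀ a b : A, (a ⇨ b) ⊔ (b ⇨ a) = ⊤

/-- Direct products of BL-algebras, with coordinatewise operations. -/
instance piBLAlgebra {ι : Type u} (A : ι → Type u) [∀ i, BLAlgebra (A i)] :
    BLAlgebra (∀ i, A i) where
  himp a b := fun i => a i ⇨ b i
  one_eq_top := funext fun _ => ResiduatedLattice.one_eq_top
  mul_le_iff_le_himp a b c :=
    forall_congr' fun i => ResiduatedLattice.mul_le_iff_le_himp (a i) (b i) (c i)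
  inf_eq_mul_himp a b := funext fun i => BLAlgebra.inf_eq_mul_himp (a i) (b i)
  himp_sup_himp a b := funext fun i => BLAlgebra.himp_sup_himp (a i) (b i)

/-- `f` is a homomorphism of BL-algebras. -/
structure IsBLHom {A B : Type u} [BLAlgebra A] [BLAlgebra B] (f : A → B) : Prop where
  map_inf : ∀ a b, f (a ⊓ b) = f a ⊓ f b
  map_sup : ∀ a b, f (a ⊔ b) = f a ⊔ f b
  map_mul : ∀ a b, f (a * b) = f a * f b
  map_himp : ∀ a b, f (a ⇨ b) = f a ⇨ f b
  map_bot : f ⊥ = ⊥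
  map_top : f ⊤ = ⊤

/-- A variety of BL-algebras: a class of BL-algebras closed under homomorphic images, (isomorphic
copies of) subalgebras and direct products. -/
structure BLVariety where
  Mem : (A : Type u) → [BLAlgebra A] → Prop
  closed_image : ∀ (A B : Type u) [BLAlgebra A] [BLAlgebra B] (f : A → B),
    IsBLHom f → Function.Surjective f → Mem A → Mem B
  closed_subalgebra : ∀ (A B : Type u) [BLAlgebra A] [BLAlgebra B] (f : A → B),
    IsBLHom f → Function.Injective f → Mem B → Mem A
  closed_product : ∀ (ι : Type u) (A : ι → Type u) [∀ i, BLAlgebra (A i)],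
    (∀ i, Mem (A i)) → Mem (∀ i, A i)

/-- Unary terms `t(x)` in the language of residuated lattices. -/
inductive UTerm : Type
  | x : UTerm
  | bot : UTerm
  | top : UTerm
  | inf : UTerm → UTerm → UTerm
  | sup : UTerm → UTerm → UTerm
  | mul : UTerm → UTerm → UTerm
  | himp : UTerm → UTerm → UTerm

namespace UTerm

/-- The interpretation `t^A : A → A` of a unary term. -/
def eval {A : Type u} [ResiduatedLattice A] : UTerm → A → A
  | x, a => a
  | bot, _ => ⊥
  | top, _ => ⊤
  | inf s t, a => eval s a ⊓ eval t a
  | sup s t, a => eval s a ⊔ eval t a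
  | mul s t, a => eval s a * eval t a
  | himp s t, a => eval s a ⇨ eval t a

/-- Negation `¬t := t → ⊥`. -/
def neg (t : UTerm) : UTerm := himp t bot

/-- Powers: `t ^ 0 := ⊤`, `t ^ (n + 1) := t ^ n · t`. -/
def pow (t : UTerm) : ℕ → UTerm
  | 0 => top
  | n + 1 => mul (pow t n) t

/-- `s_m(x) := ¬¬x ∧ ((x^m → x^(m+1)) → x)`. -/
def sTerm (m : ℕ) : UTerm :=
  inf (neg (neg x)) (himp (himp (pow x m) (pow x (m + 1))) x)

/-- `t_m(x) := ¬¬x ∧ (x^m → x^(m+1))`. -/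
def tTerm (m : ℕ) : UTerm :=
  inf (neg (neg x)) (himp (pow x m) (pow x (m + 1)))

end UTerm

/-- A nucleus on a residuated lattice: a closure operator `γ` with `γ a · γ b ≤ γ (a · b)`. -/
structure IsNucleus {A : Type u} [ResiduatedLattice A] (γ : A → A) : Prop where
  le_apply : ∀ a, a ≤ γ a
  monotone : ∀ a b, a ≤ b → γ a ≤ γ b
  idempotent : ∀ a, γ a = γ (γ a)
  mul_le : ∀ a b, γ a * γ b ≤ γ (a * b)

/-- The term `t(x)` is a nucleus on the variety `V`: its interpretation is a nucleus on every
member of `V`. -/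
def IsNucleusOn (t : UTerm) (V : BLVariety.{u}) : Prop :=
  ∀ (A : Type u) [BLAlgebra A], V.Mem A → IsNucleus (t.eval : A → A)

/-- A BL-chain: a totally ordered BL-algebra. -/
def IsBLChain (A : Type u) [BLAlgebra A] : Prop := ∀ a b : A, a ≤ b ∨ b ≤ a

/-- The subset `S` of a BL-algebra, with the restrictions of `·`, `→` and `⊤`, is a nontrivial
totally ordered Wajsberg hoop. (The order of a hoop is given by `a ≤ b ↔ a → b = ⊤`.) -/
structure IsTOWajsbergHoop {A : Type u} [BLAlgebra A] (S : Set A) : Prop where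
  top_mem : ⊤ ∈ S
  mul_mem : ∀ a ∈ S, ∀ b ∈ S, a * b ∈ S
  himp_mem : ∀ a ∈ S, ∀ b ∈ S, a ⇨ b ∈ S
  mul_assoc : ∀ a ∈ S, ∀ b ∈ S, ∀ c ∈ S, (a * b) * c = a * (b * c)
  mul_comm : ∀ a ∈ S, ∀ b ∈ S, a * b = b * a
  mul_top : ∀ a ∈ S, a * ⊤ = a
  himp_self : ∀ a ∈ S, a ⇨ a = ⊤
  mul_himp_comm : ∀ a ∈ S, ∀ b ∈ S, a * (a ⇨ b) = b * (b ⇨ a)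
  himp_himp : ∀ a ∈ S, ∀ b ∈ S, ∀ c ∈ S, a ⇨ (b ⇨ c) = (a * b) ⇨ c
  wajsberg : ∀ a ∈ S, ∀ b ∈ S, (a ⇨ b) ⇨ b = (b ⇨ a) ⇨ a
  total : ∀ a ∈ S, ∀ b ∈ S, a ⇨ b = ⊤ ∨ b ⇨ a = ⊤
  nontrivial : ∃ a ∈ S, a ≠ ⊤

/-- `A = (⨁_{i ∈ I} C i)⁺`: the BL-algebra `A` is the ordinal sum, over the total order `I` with
first element `⊥`, of the nontrivial totally ordered Wajsberg hoops `C i` (the components), which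
pairwise meet in `{⊤}` only, and the first component contains the least element of `A`. -/
structure IsOrdinalSum {A : Type u} [BLAlgebra A] {I : Type u} [LinearOrder I] [OrderBot I]
    (C : I → Set A) : Prop where
  hoop : ∀ i, IsTOWajsbergHoop (C i)
  inter : ∀ i j, i ≠ j → C i ∩ C j = {⊤}
  cover : ⋃ i, C i = Set.univ
  bot_mem : ⊥ ∈ C ⊥
  mul_left : ∀ i j, i < j → ∀ a ∈ C i \ {⊤}, ∀ b ∈ C j, a * b = a
  mul_right : ∀ i j, i < j → ∀ a ∈ C i \ {⊤}, ∀ b ∈ C j, b * a = a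
  himp_top : ∀ i j, i < j → ∀ a ∈ C i \ {⊤}, ∀ b ∈ C j, a ⇨ b = ⊤
  himp_low : ∀ i j, i < j → ∀ a ∈ C i, ∀ b ∈ C j, b ⇨ a = a

/-- `I_b`: the indices of the components that have a first element. -/
def boundedIdx {A : Type u} [BLAlgebra A] {I : Type u} (C : I → Set A) : Set I :=
  {i | ∃ b ∈ C i, ∀ a ∈ C i, b ≤ a}

/-- `I_u`: the indices of the unbounded components. -/
def unboundedIdx {A : Type u} [BLAlgebra A] {I : Type u} (C : I → Set A) : Set I :=
  {i | ¬ ∃ b ∈ C i, ∀ a ∈ C i, b ≤ a}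

end BLNuclei

open BLNuclei

/-! Each nucleus axiom is an inequality or equation between terms, preserved by homomorphic images.
An inequality failing in a BL-algebra still fails in some quotient chain (`exists_chain_quotient`),
and that chain stays in the variety. So only chains matter.

A nontrivial chain is an ordinal sum of Wajsberg hoops (`exists_isOrdinalSum`): elements other than
`⊤` share a component when the same `x` satisfy `x → a = a`. The heart is `himp_himp_eq`, the
Wajsberg identity for any pair `x ≤ y` with `y → x ≠ x`.

On the first component double negation is the identity, and so are both terms. On every other
component it is `⊤`, leaving `(x^m → x^(m+1)) → x` and `x^m → x^(m+1)`. An unbounded hoop is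
cancellative, so there `s_m` is `⊤` and `t_m` is the identity. Where `a^m = a^(m+1)` the roles are
swapped. Under the stated conditions each term is thus the identity below a cut and `⊤` above it,
which is a nucleus (`isNucleus_of_lower`).

Conversely, the least element of a bounded component beyond the first is idempotent, hence fixed by
`s_m` and sent to `⊤` by `t_m`. Monotonicity then forces the order of the components, and for `t_m`
also the power identity. For `s_m` that identity comes from multiplicativity. -/

namespace BLNuclei

/-! ### Arithmetic of residuated lattices -/

section ResiduatedLattice

open ResiduatedLattice

variable {A : Type u} [ResiduatedLattice A] {a b c d : A}

theorem le_himp_iff : a ≤ b ⇨ c ↔ a * b ≤ c := (mul_le_iff_le_himp a b c).symm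

theorem top_mul (a : A) : ⊤ * a = a := by rw [← one_eq_top, one_mul]

theorem mul_top (a : A) : a * ⊤ = a := by rw [← one_eq_top, mul_one]

theorem himp_mul_le (a b : A) : (a ⇨ b) * a ≤ b := le_himp_iff.1 le_rfl

theorem mul_le_mul_right (h : a ≤ b) (c : A) : a * c ≤ b * c :=
  le_himp_iff.1 (h.trans (le_himp_iff.2 le_rfl))

theorem mul_le_mul_left (h : a ≤ b) (c : A) : c * a ≤ c * b := by
  rw [mul_comm c a, mul_comm c b]; exact mul_le_mul_right h c

theorem mul_le_mul_both (h : a ≤ b) (h' : c ≤ d) : a * c ≤ b * d :=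
  (mul_le_mul_right h c).trans (mul_le_mul_left h' b)

theorem mul_le_right (a b : A) : a * b ≤ b :=
  (mul_le_mul_right le_top b).trans (top_mul b).le

theorem mul_le_left (a b : A) : a * b ≤ a := by
  rw [mul_comm]; exact mul_le_right b a

theorem le_himp (a b : A) : a ≤ b ⇨ a := le_himp_iff.2 (mul_le_left a b)

theorem himp_eq_top : a ⇨ b = ⊤ ↔ a ≤ b := by
  rw [← top_le_iff, le_himp_iff, top_mul]

theorem himp_self (a : A) : a ⇨ a = ⊤ := himp_eq_top.2 le_rfl

theorem top_himp (a : A) : ⊤ ⇨ a = a :=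
  le_antisymm (by simpa [mul_top] using himp_mul_le ⊤ a) (le_himp a ⊤)

theorem himp_top (a : A) : a ⇨ ⊤ = ⊤ := himp_eq_top.2 le_top

theorem himp_himp (a b c : A) : a ⇨ (b ⇨ c) = (a * b) ⇨ c :=
  eq_of_forall_le_iff fun x => by rw [le_himp_iff, le_himp_iff, le_himp_iff, mul_assoc]

theorem himp_left_comm (a b c : A) : a ⇨ (b ⇨ c) = b ⇨ (a ⇨ c) := by
  rw [himp_himp, himp_himp, mul_comm]

theorem himp_le_himp_right (h : a ≤ b) (c : A) : b ⇨ c ≤ a ⇨ c :=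
  le_himp_iff.2 ((mul_le_mul_left h _).trans (himp_mul_le b c))

theorem himp_le_himp_left (h : a ≤ b) (c : A) : c ⇨ a ≤ c ⇨ b :=
  le_himp_iff.2 ((himp_mul_le c a).trans h)

theorem le_himp_himp (a b : A) : a ≤ (a ⇨ b) ⇨ b :=
  le_himp_iff.2 (by rw [mul_comm]; exact himp_mul_le a b)

theorem himp_himp_himp (a b : A) : ((a ⇨ b) ⇨ b) ⇨ b = a ⇨ b :=
  le_antisymm (himp_le_himp_right (le_himp_himp a b) b) (le_himp_himp _ b)

theorem mul_sup (a b c : A) : a * (b ⊔ c) = a * b ⊔ a * c := by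
  refine le_antisymm ?_ (sup_le (mul_le_mul_left le_sup_left a) (mul_le_mul_left le_sup_right a))
  rw [mul_comm, ← le_himp_iff]
  exact sup_le (le_himp_iff.2 (by rw [mul_comm]; exact le_sup_left))
    (le_himp_iff.2 (by rw [mul_comm]; exact le_sup_right))

theorem sup_mul_sup_le (a b c : A) : (a ⊔ c) * (b ⊔ c) ≤ a * b ⊔ c := by
  rw [mul_sup, mul_comm (a ⊔ c) b, mul_sup]
  refine sup_le (sup_le ?_ ?_) ?_
  · rw [mul_comm]; exact le_sup_left
  · exact (mul_le_right b c).trans le_sup_right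
  · exact (mul_le_right _ c).trans le_sup_right

end ResiduatedLattice

open ResiduatedLattice

/-! ### Deductive filters and quotients -/

/-- A deductive filter of a residuated lattice. -/
structure IsDeductiveFilter {A : Type u} [ResiduatedLattice A] (F : Set A) : Prop where
  top_mem : ⊤ ∈ F
  mul_mem : ∀ a ∈ F, ∀ b ∈ F, a * b ∈ F
  upward : ∀ a ∈ F, ∀ b, a ≤ b → b ∈ F

namespace IsDeductiveFilter

section ResiduatedLattice

variable {A : Type u} [ResiduatedLattice A] {F : Set A}

theorem himp_mem_iff (hF : IsDeductiveFilter F) {a b : A} :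
    a ⇨ b ∈ F ↔ ∃ f ∈ F, f * a ≤ b :=
  ⟨fun h => ⟨_, h, himp_mul_le a b⟩, fun ⟨f, hf, h⟩ => hF.upward f hf _ (le_himp_iff.2 h)⟩

theorem sup_right (hF : IsDeductiveFilter F) (q : A) : IsDeductiveFilter {z | z ⊔ q ∈ F} where
  top_mem := hF.upward _ hF.top_mem _ le_sup_left
  mul_mem _ ha _ hb := hF.upward _ (hF.mul_mem _ ha _ hb) _ (sup_mul_sup_le _ _ q)
  upward _ ha _ h := hF.upward _ ha _ (sup_le_sup_right h q)

theorem exists_maximal (c : A) (hc : c ≠ ⊤) :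
    ∃ F : Set A, Maximal (fun F => IsDeductiveFilter F ∧ c ∉ F) F := by
  refine zorn_subset {F : Set A | IsDeductiveFilter F ∧ c ∉ F} fun S hS hchain => ?_
  rcases S.eq_empty_or_nonempty with rfl | ⟨F₀, hF₀⟩
  · refine ⟨{⊤}, ⟨⟨rfl, ?_, ?_⟩, hc⟩, by simp⟩
    · rintro a rfl b rfl; exact top_mul _
    · rintro a rfl b h; exact top_le_iff.1 h
  · refine ⟨⋃₀ S, ⟨⟨⟨F₀, hF₀, (hS hF₀).1.top_mem⟩, ?_, ?_⟩, ?_⟩, fun s => Set.subset_sUnion_of_mem⟩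
    · rintro a ⟨G, hG, ha⟩ b ⟨H, hH, hb⟩
      rcases hchain.total hG hH with h | h
      · exact ⟨H, hH, (hS hH).1.mul_mem a (h ha) b hb⟩
      · exact ⟨G, hG, (hS hG).1.mul_mem a ha b (h hb)⟩
    · rintro a ⟨G, hG, ha⟩ b h
      exact ⟨G, hG, (hS hG).1.upward a ha b h⟩
    · rintro ⟨G, hG, h⟩
      exact (hS hG).2 h

/-- Maximality makes `F` prime: the filters `{z | z ⊔ q ∈ F}` and `{z | z ⊔ c ∈ F}` contain `F`, so
whichever of them omits `c` is `F` itself. The second always omits `c`, since `c ⊔ c = c`, but it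
contains `q` only when `c ⊔ q ∈ F`. -/
theorem mem_or_mem_of_maximal {c : A} (hF : Maximal (fun F => IsDeductiveFilter F ∧ c ∉ F) F)
    {p q : A} (h : p ⊔ q ∈ F) : p ∈ F ∨ q ∈ F := by
  obtain ⟨hD, hc⟩ := hF.prop
  have sub : ∀ q : A, F ⊆ {z | z ⊔ q ∈ F} := fun q z hz => hD.upward z hz _ le_sup_left
  by_cases hcq : c ⊔ q ∈ F
  · right
    exact hF.le_of_ge (y := {z | z ⊔ c ∈ F}) ⟨hD.sup_right c, by simpa using hc⟩ (sub c)
      (show q ⊔ c ∈ F by rwa [sup_comm])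
  · left
    exact hF.le_of_ge (y := {z | z ⊔ q ∈ F}) ⟨hD.sup_right q, hcq⟩ (sub q) h

theorem himp_trans (hF : IsDeductiveFilter F) {a b c : A} (h : a ⇨ b ∈ F) (h' : b ⇨ c ∈ F) :
    a ⇨ c ∈ F := by
  obtain ⟨f, hf, h⟩ := hF.himp_mem_iff.1 h
  obtain ⟨g, hg, h'⟩ := hF.himp_mem_iff.1 h'
  refine hF.himp_mem_iff.2 ⟨g * f, hF.mul_mem g hg f hf, ?_⟩
  rw [mul_assoc]
  exact (mul_le_mul_left h g).trans h'

theorem himp_refl (hF : IsDeductiveFilter F) {a b : A} (h : a ≤ b) : a ⇨ b ∈ F := by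
  rw [himp_eq_top.2 h]; exact hF.top_mem

theorem inf_himp_inf (hF : IsDeductiveFilter F) {a b c d : A} (h : a ⇨ b ∈ F) (h' : c ⇨ d ∈ F) :
    a ⊓ c ⇨ b ⊓ d ∈ F := by
  obtain ⟨f, hf, h⟩ := hF.himp_mem_iff.1 h
  obtain ⟨g, hg, h'⟩ := hF.himp_mem_iff.1 h'
  refine hF.himp_mem_iff.2 ⟨f * g, hF.mul_mem f hf g hg, le_inf ?_ ?_⟩
  · exact (mul_le_mul_both (mul_le_left f g) inf_le_left).trans h
  · exact (mul_le_mul_both (mul_le_right f g) inf_le_right).trans h'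

theorem sup_himp_sup (hF : IsDeductiveFilter F) {a b c d : A} (h : a ⇨ b ∈ F) (h' : c ⇨ d ∈ F) :
    a ⊔ c ⇨ b ⊔ d ∈ F := by
  obtain ⟨f, hf, h⟩ := hF.himp_mem_iff.1 h
  obtain ⟨g, hg, h'⟩ := hF.himp_mem_iff.1 h'
  refine hF.himp_mem_iff.2 ⟨f * g, hF.mul_mem f hf g hg, ?_⟩
  rw [mul_sup]
  exact sup_le_sup ((mul_le_mul_right (mul_le_left f g) a).trans h)
    ((mul_le_mul_right (mul_le_right f g) c).trans h')

theorem mul_himp_mul (hF : IsDeductiveFilter F) {a b c d : A} (h : a ⇨ b ∈ F) (h' : c ⇨ d ∈ F) :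
    a * c ⇨ b * d ∈ F := by
  obtain ⟨f, hf, h⟩ := hF.himp_mem_iff.1 h
  obtain ⟨g, hg, h'⟩ := hF.himp_mem_iff.1 h'
  refine hF.himp_mem_iff.2 ⟨f * g, hF.mul_mem f hf g hg, ?_⟩
  rw [mul_mul_mul_comm]
  exact mul_le_mul_both h h'

theorem himp_himp_himp_mem (hF : IsDeductiveFilter F) {a b c d : A} (h : b ⇨ a ∈ F) (h' : c ⇨ d ∈ F) :
    (a ⇨ c) ⇨ (b ⇨ d) ∈ F := by
  obtain ⟨f, hf, h⟩ := hF.himp_mem_iff.1 h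
  obtain ⟨g, hg, h'⟩ := hF.himp_mem_iff.1 h'
  refine hF.himp_mem_iff.2 ⟨g * f, hF.mul_mem g hg f hf, le_himp_iff.2 ?_⟩
  calc g * f * (a ⇨ c) * b = g * ((a ⇨ c) * (f * b)) := by
        simp only [mul_assoc, mul_left_comm f]
    _ ≤ g * ((a ⇨ c) * a) := mul_le_mul_left (mul_le_mul_left h _) g
    _ ≤ g * c := mul_le_mul_left (himp_mul_le a c) g
    _ ≤ d := h'

/-- The congruence of a deductive filter. -/
def setoid (hF : IsDeductiveFilter F) : Setoid A where
  r a b := a ⇨ b ∈ F ∧ b ⇨ a ∈ F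
  iseqv := ⟨fun _ => ⟨hF.himp_refl le_rfl, hF.himp_refl le_rfl⟩, fun h => ⟨h.2, h.1⟩,
    fun h h' => ⟨hF.himp_trans h.1 h'.1, hF.himp_trans h'.2 h.2⟩⟩

/-- The quotient by a deductive filter. -/
def Quot (hF : IsDeductiveFilter F) : Type u := Quotient hF.setoid

/-- The projection onto the quotient by a deductive filter. -/
def proj (hF : IsDeductiveFilter F) (a : A) : hF.Quot := Quotient.mk hF.setoid a

theorem proj_surjective (hF : IsDeductiveFilter F) : Function.Surjective hF.proj :=
  Quotient.mk_surjective

theorem proj_eq_proj (hF : IsDeductiveFilter F) {a b : A} :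
    hF.proj a = hF.proj b ↔ a ⇨ b ∈ F ∧ b ⇨ a ∈ F :=
  Quotient.eq (r := hF.setoid)

end ResiduatedLattice

variable {A : Type u} [BLAlgebra A] {F : Set A}

instance quotBLAlgebra (hF : IsDeductiveFilter F) : BLAlgebra hF.Quot where
  le := Quotient.lift₂ (fun a b => a ⇨ b ∈ F) fun _ _ _ _ h h' => propext
    ⟨fun k => hF.himp_trans h.2 (hF.himp_trans k h'.1),
      fun k => hF.himp_trans h.1 (hF.himp_trans k h'.2)⟩
  inf := Quotient.map₂ (· ⊓ ·) fun _ _ h _ _ h' => ⟨hF.inf_himp_inf h.1 h'.1,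
    hF.inf_himp_inf h.2 h'.2⟩
  sup := Quotient.map₂ (· ⊔ ·) fun _ _ h _ _ h' => ⟨hF.sup_himp_sup h.1 h'.1,
    hF.sup_himp_sup h.2 h'.2⟩
  mul := Quotient.map₂ (· * ·) fun _ _ h _ _ h' => ⟨hF.mul_himp_mul h.1 h'.1,
    hF.mul_himp_mul h.2 h'.2⟩
  himp := Quotient.map₂ (· ⇨ ·) fun _ _ h _ _ h' => ⟨hF.himp_himp_himp_mem h.2 h'.1,
    hF.himp_himp_himp_mem h.1 h'.2⟩
  one := hF.proj 1
  top := hF.proj ⊤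
  bot := hF.proj ⊥
  le_refl := Quotient.ind fun _ => hF.himp_refl le_rfl
  le_trans := by
    rintro ⟨a⟩ ⟨b⟩ ⟨c⟩; exact hF.himp_trans
  le_antisymm := by
    rintro ⟨a⟩ ⟨b⟩ h h'; exact hF.proj_eq_proj.2 ⟨h, h'⟩
  le_sup_left := by
    rintro ⟨a⟩ ⟨b⟩; exact hF.himp_refl le_sup_left
  le_sup_right := by
    rintro ⟨a⟩ ⟨b⟩; exact hF.himp_refl le_sup_right
  sup_le := by
    rintro ⟨a⟩ ⟨b⟩ ⟨c⟩ h h'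
    exact hF.himp_trans (hF.sup_himp_sup h h') (hF.himp_refl (sup_idem c).le)
  inf_le_left := by
    rintro ⟨a⟩ ⟨b⟩; exact hF.himp_refl inf_le_left
  inf_le_right := by
    rintro ⟨a⟩ ⟨b⟩; exact hF.himp_refl inf_le_right
  le_inf := by
    rintro ⟨a⟩ ⟨b⟩ ⟨c⟩ h h'
    exact hF.himp_trans (hF.himp_refl (inf_idem a).ge) (hF.inf_himp_inf h h')
  le_top := Quotient.ind fun _ => hF.himp_refl le_top
  bot_le := Quotient.ind fun _ => hF.himp_refl bot_le
  mul_assoc := by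
    rintro ⟨a⟩ ⟨b⟩ ⟨c⟩; exact congrArg hF.proj (mul_assoc a b c)
  mul_comm := by
    rintro ⟨a⟩ ⟨b⟩; exact congrArg hF.proj (mul_comm a b)
  one_mul := by
    rintro ⟨a⟩; exact congrArg hF.proj (one_mul a)
  mul_one := by
    rintro ⟨a⟩; exact congrArg hF.proj (mul_one a)
  one_eq_top := congrArg hF.proj one_eq_top
  mul_le_iff_le_himp := by
    rintro ⟨a⟩ ⟨b⟩ ⟨c⟩
    exact iff_of_eq (congrArg (· ∈ F) (himp_himp a b c).symm)
  inf_eq_mul_himp := by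
    rintro ⟨a⟩ ⟨b⟩; exact congrArg hF.proj (BLAlgebra.inf_eq_mul_himp a b)
  himp_sup_himp := by
    rintro ⟨a⟩ ⟨b⟩; exact congrArg hF.proj (BLAlgebra.himp_sup_himp a b)

theorem isBLHom_proj (hF : IsDeductiveFilter F) : IsBLHom hF.proj :=
  ⟨fun _ _ => rfl, fun _ _ => rfl, fun _ _ => rfl, fun _ _ => rfl, rfl, rfl⟩

end IsDeductiveFilter

/-! ### Reduction to chains -/

namespace IsBLHom

variable {A B : Type u} [BLAlgebra A] [BLAlgebra B] {f : A → B}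

theorem monotone (hf : IsBLHom f) : Monotone f := fun a b h =>
  inf_eq_left.1 (by rw [← hf.map_inf, inf_eq_left.2 h])

theorem map_eval (hf : IsBLHom f) (t : UTerm) (a : A) : f (t.eval a) = t.eval (f a) := by
  induction t with
  | x => rfl
  | bot => exact hf.map_bot
  | top => exact hf.map_top
  | inf s t hs ht => simp only [UTerm.eval, hf.map_inf, hs, ht]
  | sup s t hs ht => simp only [UTerm.eval, hf.map_sup, hs, ht]
  | mul s t hs ht => simp only [UTerm.eval, hf.map_mul, hs, ht]
  | himp s t hs ht => simp only [UTerm.eval, hf.map_himp, hs, ht]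

end IsBLHom

/-- In the quotient by `F`, `x ≤ y` means `x ⇨ y ∈ F`. For `F` maximal among filters omitting `a ⇨
b`, primeness and prelinearity make the quotient total. -/
theorem exists_chain_quotient {A : Type u} [BLAlgebra A] {a b : A} (h : ¬ a ≤ b) :
    ∃ (B : Type u) (_ : BLAlgebra B) (f : A → B), IsBLHom f ∧ Function.Surjective f ∧
      IsBLChain B ∧ ¬ f a ≤ f b := by
  obtain ⟨F, hF⟩ := IsDeductiveFilter.exists_maximal (a ⇨ b) (mt himp_eq_top.1 h)
  obtain ⟨hD, hab⟩ := hF.prop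
  refine ⟨hD.Quot, inferInstance, hD.proj, hD.isBLHom_proj, hD.proj_surjective, ?_, hab⟩
  rintro ⟨x⟩ ⟨y⟩
  refine IsDeductiveFilter.mem_or_mem_of_maximal hF ?_
  rw [BLAlgebra.himp_sup_himp]
  exact hD.top_mem

theorem isNucleusOn_iff_chain {V : BLVariety.{u}} {t : UTerm} :
    IsNucleusOn t V ↔ ∀ (A : Type u) [BLAlgebra A], V.Mem A → IsBLChain A →
      IsNucleus (t.eval : A → A) := by
  refine ⟨fun h A _ hA _ => h A hA, fun h A _ hA => ?_⟩
  have key : ∀ a b : A, (∀ (B : Type u) [BLAlgebra B] (f : A → B), IsBLHom f →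
      IsNucleus (t.eval : B → B) → f a ≤ f b) → a ≤ b := by
    intro a b hab
    by_contra hn
    obtain ⟨B, _, f, hf, hs, hc, hfn⟩ := exists_chain_quotient hn
    exact hfn (hab B f hf (h B (V.closed_image A B f hf hs hA) hc))
  refine ⟨fun a => key _ _ fun B _ f hf hB => ?_, fun a b hab => key _ _ fun B _ f hf hB => ?_,
    fun a => le_antisymm (key _ _ fun B _ f hf hB => ?_) (key _ _ fun B _ f hf hB => ?_),
    fun a b => key _ _ fun B _ f hf hB => ?_⟩
  · rw [hf.map_eval]; exact hB.le_apply _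
  · rw [hf.map_eval, hf.map_eval]; exact hB.monotone _ _ (hf.monotone hab)
  · simp only [hf.map_eval]; exact (hB.idempotent _).le
  · simp only [hf.map_eval]; exact (hB.idempotent _).ge
  · rw [hf.map_mul, hf.map_eval, hf.map_eval, hf.map_eval, hf.map_mul]; exact hB.mul_le _ _

/-! ### The ordinal sum decomposition of BL-chains -/

section Decomposition

variable {A : Type u} [BLAlgebra A]

theorem mul_himp_of_le {a b : A} (h : b ≤ a) : a * (a ⇨ b) = b := by
  rw [← BLAlgebra.inf_eq_mul_himp, inf_eq_right.2 h]

theorem mul_eq_of_le_of_mul_eq {a b w : A} (h : a ≤ b) (hw : w * b = b) : w * a = a := by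
  rw [← mul_himp_of_le h, ← mul_assoc, hw]

/-- With `e = y ⇨ x`, `z = e ⇨ x` and `w = z ⇨ y`, divisibility gives `e * z = x` and `z * w = y`,
and currying gives `w ⇨ e = e`. Comparing `w` with `z` and with `e` forces `z = y`. -/
theorem IsBLChain.himp_himp_eq (hA : IsBLChain A) {x y : A} (hxy : x ≤ y)
    (hx : y ⇨ x ≠ x) : (y ⇨ x) ⇨ x = y := by
  have hxe : x ≤ y ⇨ x := le_himp x y
  have hyz : y ≤ (y ⇨ x) ⇨ x := le_himp_himp y x
  have hzx : ((y ⇨ x) ⇨ x) ⇨ x = y ⇨ x := BLNuclei.himp_himp_himp y x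
  generalize he : y ⇨ x = e at *
  generalize hz : e ⇨ x = z at *
  have hez : e * z = x := by rw [← hz, mul_himp_of_le hxe]
  have hzw : z * (z ⇨ y) = y := mul_himp_of_le hyz
  have hwe : (z ⇨ y) ⇨ e = e := by rw [← hzx, himp_himp, mul_comm, hzw, he, hzx]
  generalize z ⇨ y = w at *
  rcases hA w z with hwz | hzw'
  -- Here `z ⊓ e = z * e = x`; being in a chain, `z` or `e` equals `x`, and `e = x` is excluded.
  · have hze : z ⇨ e = e := le_antisymm ((himp_le_himp_right hwz e).trans hwe.le) (le_himp e z)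
    have hinf : z ⊓ e = x := by rw [BLAlgebra.inf_eq_mul_himp, hze, mul_comm, hez]
    rcases hA z e with h | h
    · rw [inf_eq_left.2 h] at hinf
      exact le_antisymm (hinf.trans_le hxy) hyz
    · rw [inf_eq_right.2 h] at hinf
      exact absurd hinf hx
  · rcases hA w e with h | h
    · rw [himp_eq_top.2 h] at hwe
      rw [← hwe, himp_eq_top] at he
      rw [← hwe, top_himp] at hz
      rw [← hz]; exact le_antisymm hxy he
    -- Since `w` acts as a unit on `e`, `(w ⇨ z) * e = e * z = x`, so `w ⇨ z ≤ z` and `z = w * (w ⇨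
    -- z) ≤ w * z = y`.
    · have hwe' : w * e = e := by simpa only [hwe] using mul_himp_of_le h
      have hwq : w * (w ⇨ z) = z := mul_himp_of_le hzw'
      have hq : w ⇨ z ≤ z := by
        rw [← hz, le_himp_iff, hz]
        calc (w ⇨ z) * e = e * (w * (w ⇨ z)) := by
              rw [← mul_assoc, mul_comm e w, hwe', mul_comm]
          _ ≤ x := by rw [hwq, hez]
      refine le_antisymm ?_ hyz
      calc z = w * (w ⇨ z) := hwq.symm
        _ ≤ w * z := mul_le_mul_left hq w
        _ = y := by rw [mul_comm, hzw]

/-- The set of all `x` with `x → a = a`. -/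
def fixer (a : A) : Set A := {x | x ⇨ a = a}

/-- If `x` fixes `b`, multiplication by `x` is the identity below `b`. It is therefore the identity
on `x ⇨ a ≤ b`, while divisibility gives `x * (x ⇨ a) = a`. -/
theorem IsBLChain.fixer_anti (hA : IsBLChain A) {a b : A} (h : a ≤ b) (hb : b ≠ ⊤) :
    fixer b ⊆ fixer a := by
  intro x (hx : x ⇨ b = b)
  have hbx : b ≤ x := (hA b x).resolve_right fun h => hb (by rw [← hx, himp_eq_top.2 h])
  have hxb : x * b = b := by simpa only [hx] using mul_himp_of_le hbx
  have heb : x ⇨ a ≤ b := (himp_le_himp_left h x).trans hx.le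
  have := mul_eq_of_le_of_mul_eq heb hxb
  rw [mul_himp_of_le (h.trans hbx)] at this
  exact this.symm

/-- Fixers are upward closed, and upward closed subsets of a chain are comparable. -/
theorem IsBLChain.fixer_total (hA : IsBLChain A) (a b : A) :
    fixer a ⊆ fixer b ∨ fixer b ⊆ fixer a := by
  by_contra! hn
  simp only [Set.not_subset] at hn
  obtain ⟨⟨x, hx, hx'⟩, y, hy, hy'⟩ := hn
  rcases hA x y with h | h
  · exact hy' (le_antisymm ((himp_le_himp_right h a).trans (le_of_eq hx)) (le_himp a y))
  · exact hx' (le_antisymm ((himp_le_himp_right h b).trans (le_of_eq hy)) (le_himp b x))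

/-- Otherwise `b = (b ⇨ a) ⇨ a`, and exchanging implications shows that whatever fixes `a` also
fixes `b`. -/
theorem IsBLChain.himp_eq_of_fixer_ne (hA : IsBLChain A) {a b : A} (h : a ≤ b) (hb : b ≠ ⊤)
    (hne : fixer a ≠ fixer b) : b ⇨ a = a := by
  by_contra hba
  obtain ⟨x, hx, hxb⟩ := Set.not_subset.1 fun h' => hne (h'.antisymm (hA.fixer_anti h hb))
  refine hxb ?_
  change x ⇨ b = b
  rw [← hA.himp_himp_eq h hba, himp_left_comm, hx]

theorem himp_ne_of_fixer_eq {a b : A} (hb : b ≠ ⊤) (h : fixer a = fixer b) : b ⇨ a ≠ a := by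
  intro hba
  have : b ∈ fixer b := h ▸ hba
  exact hb (Eq.trans (Eq.symm this) (himp_self b))

/-- The index set of the decomposition of a BL-chain. -/
def FixerIdx (A : Type u) [BLAlgebra A] : Type u := {S : Set A // ∃ a : A, a ≠ ⊤ ∧ fixer a = S}

/-- The fixers of a BL-chain are linearly ordered by reverse inclusion. -/
@[reducible] noncomputable def IsBLChain.fixerOrder (hA : IsBLChain A) : LinearOrder (FixerIdx A) where
  le S T := T.1 ⊆ S.1
  le_refl S := subset_rfl
  le_trans S T U h h' := h'.trans h
  le_antisymm S T h h' := Subtype.ext (h'.antisymm h)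
  le_total := by
    rintro ⟨_, a, -, rfl⟩ ⟨_, b, -, rfl⟩
    exact hA.fixer_total b a
  toDecidableLE := Classical.decRel _

/-- The component of a BL-chain at an index. -/
def fixerComponent (i : FixerIdx A) : Set A := {a | a = ⊤ ∨ fixer a = i.1}

theorem IsBLChain.isTOWajsbergHoop_fixerComponent (hA : IsBLChain A) (i : FixerIdx A) :
    IsTOWajsbergHoop (fixerComponent i) where
  top_mem := Or.inl rfl
  mul_mem := by
    have main : ∀ a b : A, a ≠ ⊤ → b ≠ ⊤ → fixer a = fixer b → a ≤ b →
        fixer (a * b) = fixer b := by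
      intro a b ha hb hab hle
      by_contra hne
      -- A different fixer would give `a ⇨ a * b = a * b`, hence `b ≤ a * b` and `a * b = b`.
      have h1 := hA.himp_eq_of_fixer_ne (mul_le_left a b) ha (hab ▸ hne)
      have h2 : b ≤ a ⇨ a * b := le_himp_iff.2 (mul_comm b a).le
      rw [h1] at h2
      rw [le_antisymm (mul_le_right a b) h2] at hne
      exact hne rfl
    rintro a (rfl | ha) b (rfl | hb)
    · left; exact top_mul _
    · right; rwa [top_mul]
    · right; rwa [BLNuclei.mul_top]
    · by_cases ha' : a = ⊤
      · right; rwa [ha', top_mul]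
      by_cases hb' : b = ⊤
      · right; rwa [hb', BLNuclei.mul_top]
      right
      rcases hA a b with h | h
      · rw [main a b ha' hb' (ha.trans hb.symm) h, hb]
      · rw [mul_comm, main b a hb' ha' (hb.trans ha.symm) h, ha]
  himp_mem := by
    rintro a (rfl | ha) b (rfl | hb)
    · left; exact himp_self _
    · right; rwa [top_himp]
    · left; exact BLNuclei.himp_top a
    · by_cases ha' : a = ⊤
      · right; rwa [ha', top_himp]
      rcases hA a b with h | h
      · left; exact himp_eq_top.2 h
      · by_cases hab : a ⇨ b = ⊤
        · exact Or.inl hab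
        right
        have hne := himp_ne_of_fixer_eq ha' (hb.trans ha.symm)
        have heq := hA.himp_himp_eq h hne
        by_contra hn
        -- A different fixer would give `(a ⇨ b) ⇨ b = b`; but this element is `a`, so `a = b` and
        -- `a ⇨ b = ⊤`.
        have := hA.himp_eq_of_fixer_ne (le_himp b a) hab fun h' => hn (h'.symm.trans hb)
        rw [heq] at this
        rw [this, himp_self] at hab
        exact hab rfl
  mul_assoc a _ b _ c _ := mul_assoc a b c
  mul_comm a _ b _ := mul_comm a b
  mul_top a _ := BLNuclei.mul_top a
  himp_self a _ := himp_self a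
  mul_himp_comm a _ b _ := by
    rw [← BLAlgebra.inf_eq_mul_himp, ← BLAlgebra.inf_eq_mul_himp, inf_comm]
  himp_himp a _ b _ c _ := himp_himp a b c
  wajsberg := by
    have main : ∀ a ∈ fixerComponent i, ∀ b ∈ fixerComponent i, a ≤ b →
        (a ⇨ b) ⇨ b = (b ⇨ a) ⇨ a := by
      rintro a ha b hb h
      rw [himp_eq_top.2 h, top_himp]
      by_cases hb' : b = ⊤
      · rw [hb', top_himp, himp_self]
      have ha' : a ≠ ⊤ := fun h' => hb' (top_le_iff.1 (h' ▸ h))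
      exact (hA.himp_himp_eq h (himp_ne_of_fixer_eq hb'
        ((ha.resolve_left ha').trans (hb.resolve_left hb').symm))).symm
    intro a ha b hb
    rcases hA a b with h | h
    · exact main a ha b hb h
    · exact (main b hb a ha h).symm
  total a _ b _ := (hA a b).imp himp_eq_top.2 himp_eq_top.2
  nontrivial := by
    obtain ⟨_, a, ha, rfl⟩ := i
    exact ⟨a, Or.inr rfl, ha⟩

theorem IsBLChain.exists_isOrdinalSum (hA : IsBLChain A) (hn : (⊥ : A) ≠ ⊤) :
    ∃ (I : Type u) (_ : LinearOrder I) (_ : OrderBot I) (C : I → Set A), IsOrdinalSum C := by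
  let _ := hA.fixerOrder
  let _ : OrderBot (FixerIdx A) :=
    { bot := ⟨fixer ⊥, ⊥, hn, rfl⟩
      bot_le := by
        rintro ⟨_, a, ha, rfl⟩
        exact hA.fixer_anti bot_le ha }
  have low : ∀ i j : FixerIdx A, i < j → ∀ a ∈ fixerComponent i \ {⊤}, ∀ b ∈ fixerComponent j,
      a ≤ b ∧ b ⇨ a = a := by
    rintro i j hij a ⟨ha, ha'⟩ b hb
    by_cases hb' : b = ⊤
    · rw [hb', top_himp]; exact ⟨le_top, rfl⟩
    replace ha := ha.resolve_left ha'
    replace hb := hb.resolve_left hb'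
    have hle : a ≤ b := (hA a b).resolve_right fun h => hij.not_ge
      (show i.1 ⊆ j.1 by rw [← ha, ← hb]; exact hA.fixer_anti h ha')
    refine ⟨hle, hA.himp_eq_of_fixer_ne hle hb' fun h => hij.ne (Subtype.ext ?_)⟩
    rw [← ha, ← hb, h]
  have mul : ∀ i j : FixerIdx A, i < j → ∀ a ∈ fixerComponent i \ {⊤}, ∀ b ∈ fixerComponent j,
      b * a = a := by
    intro i j hij a ha b hb
    obtain ⟨h, h'⟩ := low i j hij a ha b hb
    simpa only [h'] using mul_himp_of_le h
  refine ⟨FixerIdx A, inferInstance, inferInstance, fixerComponent,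
    hA.isTOWajsbergHoop_fixerComponent, fun i j hij => ?_, ?_, Or.inr rfl, ?_, mul, ?_, ?_⟩
  · refine Set.Subset.antisymm ?_ (Set.singleton_subset_iff.2 ⟨Or.inl rfl, Or.inl rfl⟩)
    rintro a ⟨ha, ha'⟩
    by_contra h
    exact hij (Subtype.ext ((ha.resolve_left h).symm.trans (ha'.resolve_left h)))
  · refine Set.eq_univ_of_forall fun a => Set.mem_iUnion.2 ?_
    by_cases ha : a = ⊤
    · exact ⟨⊥, Or.inl ha⟩
    · exact ⟨⟨fixer a, a, ha, rfl⟩, Or.inr rfl⟩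
  · intro i j hij a ha b hb
    rw [mul_comm]; exact mul i j hij a ha b hb
  · intro i j hij a ha b hb
    exact himp_eq_top.2 (low i j hij a ha b hb).1
  · intro i j hij a ha b hb
    by_cases ha' : a = ⊤
    · rw [ha', BLNuclei.himp_top]
    · exact (low i j hij a ⟨ha, ha'⟩ b hb).2

end Decomposition

/-! ### The terms on components -/

theorem UTerm.eval_pow {A : Type u} [ResiduatedLattice A] (n : ℕ) (a : A) :
    (UTerm.pow UTerm.x n).eval a = a ^ n := by
  induction n with
  | zero => rw [pow_zero, one_eq_top]; rfl
  | succ n ih => rw [pow_succ, ← ih]; rfl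

theorem UTerm.eval_sTerm {A : Type u} [ResiduatedLattice A] (m : ℕ) (a : A) :
    (UTerm.sTerm m).eval a = ((a ⇨ ⊥) ⇨ ⊥) ⊓ ((a ^ m ⇨ a ^ (m + 1)) ⇨ a) := by
  rw [← UTerm.eval_pow, ← UTerm.eval_pow]; rfl

theorem UTerm.eval_tTerm {A : Type u} [ResiduatedLattice A] (m : ℕ) (a : A) :
    (UTerm.tTerm m).eval a = ((a ⇨ ⊥) ⇨ ⊥) ⊓ (a ^ m ⇨ a ^ (m + 1)) := by
  rw [← UTerm.eval_pow, ← UTerm.eval_pow]; rfl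

section Components

variable {A : Type u} [BLAlgebra A]

theorem le_pow_himp_pow (a : A) (m : ℕ) : a ≤ a ^ m ⇨ a ^ (m + 1) :=
  le_himp_iff.2 (pow_succ' a m).ge

/-! ### Cancellation and least elements in Wajsberg hoops -/

namespace IsTOWajsbergHoop

variable {S : Set A}

theorem pow_mem (hS : IsTOWajsbergHoop S) {a : A} (ha : a ∈ S) (n : ℕ) : a ^ n ∈ S := by
  induction n with
  | zero => rw [pow_zero, one_eq_top]; exact hS.top_mem
  | succ n ih => rw [pow_succ]; exact hS.mul_mem _ ih _ ha

theorem le_total (hS : IsTOWajsbergHoop S) {a b : A} (ha : a ∈ S) (hb : b ∈ S) :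
    a ≤ b ∨ b ≤ a :=
  (hS.total a ha b hb).imp himp_eq_top.1 himp_eq_top.1

theorem himp_himp_of_le (hS : IsTOWajsbergHoop S) {a b : A} (ha : a ∈ S) (hb : b ∈ S)
    (h : a ≤ b) : (b ⇨ a) ⇨ a = b := by
  rw [hS.wajsberg b hb a ha, himp_eq_top.2 h, top_himp]

/-- Above `c`, the map `x ↦ x ⇨ c` is injective by the Wajsberg identity, so it suffices to compare
`b` and `e = a ⇨ a * b` after applying it. Both images lie below `a`, so divisibility and currying
rewrite them as `a * (a * b ⇨ c)` and `a * (a * e ⇨ c)`, and `a * e = a * b`. -/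
theorem himp_mul_cancel (hS : IsTOWajsbergHoop S) {a b c : A} (ha : a ∈ S) (hb : b ∈ S)
    (hc : c ∈ S) (h : ¬ a * b ≤ c) : a ⇨ a * b = b := by
  have hab := hS.mul_mem a ha b hb
  have hcab : c ≤ a * b := (hS.le_total hab hc).resolve_left h
  have he := hS.himp_mem a ha _ hab
  have hbe : b ≤ a ⇨ a * b := le_himp_iff.2 (_root_.mul_comm b a).le
  have hae : a * (a ⇨ a * b) = a * b := mul_himp_of_le (mul_le_left a b)
  have hcb : c ≤ b := hcab.trans (mul_le_right a b)
  generalize a ⇨ a * b = e at *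
  suffices hpq : e ⇨ c = b ⇨ c by
    rw [← hS.himp_himp_of_le hc hb hcb, ← hS.himp_himp_of_le hc he (hcb.trans hbe), hpq]
  have hq := hS.himp_mem b hb c hc
  have hqa : b ⇨ c ≤ a := (hS.le_total hq ha).resolve_right (mt le_himp_iff.1 h)
  have hpa : e ⇨ c ≤ a := (himp_le_himp_right hbe c).trans hqa
  rw [← mul_himp_of_le hqa, ← mul_himp_of_le hpa, BLNuclei.himp_himp, BLNuclei.himp_himp, hae]

theorem pow_himp_pow_of_unbounded (hS : IsTOWajsbergHoop S)
    (h : ¬ ∃ b ∈ S, ∀ a ∈ S, b ≤ a) {a : A} (ha : a ∈ S) (m : ℕ) :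
    a ^ m ⇨ a ^ (m + 1) = a := by
  push Not at h
  obtain ⟨c, hc, hlt⟩ := h _ (hS.pow_mem ha (m + 1))
  rw [pow_succ] at hlt ⊢
  exact hS.himp_mul_cancel (hS.pow_mem ha m) ha hc hlt

theorem pow_eq_self_of_least (hS : IsTOWajsbergHoop S) {b : A} (hb : b ∈ S)
    (h : ∀ a ∈ S, b ≤ a) {n : ℕ} (hn : n ≠ 0) : b ^ n = b := by
  obtain ⟨k, rfl⟩ := Nat.exists_eq_succ_of_ne_zero hn
  exact le_antisymm (by rw [pow_succ]; exact mul_le_right _ b) (h _ (hS.pow_mem hb _))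

theorem ne_top_of_least (hS : IsTOWajsbergHoop S) {b : A} (h : ∀ a ∈ S, b ≤ a) : b ≠ ⊤ := by
  rintro rfl
  obtain ⟨a, ha, ha'⟩ := hS.nontrivial
  exact ha' (top_le_iff.1 (h a ha))

end IsTOWajsbergHoop

/-! ### The two terms on an ordinal sum -/

namespace IsOrdinalSum

variable {I : Type u} [LinearOrder I] [OrderBot I] {C : I → Set A}

theorem exists_mem (h : IsOrdinalSum C) (a : A) : ∃ i, a ∈ C i :=
  Set.mem_iUnion.1 (h.cover ▸ Set.mem_univ a)

theorem neg_neg_of_mem_bot (h : IsOrdinalSum C) {a : A} (ha : a ∈ C ⊥) : (a ⇨ ⊥) ⇨ ⊥ = a :=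
  (h.hoop ⊥).himp_himp_of_le h.bot_mem ha bot_le

theorem neg_neg_of_ne_bot (h : IsOrdinalSum C) {i : I} (hi : i ≠ ⊥) {a : A} (ha : a ∈ C i) :
    (a ⇨ ⊥) ⇨ ⊥ = ⊤ := by
  rw [h.himp_low ⊥ i (bot_lt_iff_ne_bot.2 hi) ⊥ h.bot_mem a ha, himp_self]

theorem bot_mem_boundedIdx (h : IsOrdinalSum C) : ⊥ ∈ boundedIdx C :=
  ⟨⊥, h.bot_mem, fun _ _ => bot_le⟩

theorem ne_bot_of_mem_unboundedIdx (h : IsOrdinalSum C) {j : I} (hj : j ∈ unboundedIdx C) :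
    j ≠ ⊥ := by
  rintro rfl; exact hj h.bot_mem_boundedIdx

theorem le_of_lt (h : IsOrdinalSum C) {i j : I} (hij : i < j) {a b : A} (ha : a ∈ C i)
    (ha' : a ≠ ⊤) (hb : b ∈ C j) : a ≤ b :=
  himp_eq_top.1 (h.himp_top i j hij a ⟨ha, ha'⟩ b hb)

/-- A map that is the identity on the components of a lower part of the index set, and constantly
`⊤` on the other components, is a nucleus. -/
theorem isNucleus_of_lower (h : IsOrdinalSum C) {γ : A → A} (K : Set I)
    (hK : ∀ i ∈ K, ∀ j ∉ K, i < j) (hlow : ∀ i ∈ K, ∀ a ∈ C i, γ a = a)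
    (hup : ∀ i ∉ K, ∀ a ∈ C i, γ a = ⊤) : IsNucleus γ := by
  have cases : ∀ a, γ a = a ∨ γ a = ⊤ := fun a => by
    obtain ⟨i, hi⟩ := h.exists_mem a
    by_cases hiK : i ∈ K
    · exact Or.inl (hlow i hiK a hi)
    · exact Or.inr (hup i hiK a hi)
  have le_apply : ∀ a, a ≤ γ a := fun a => by
    rcases cases a with h | h <;> rw [h]
    exact le_top
  have apply_top : γ ⊤ = ⊤ := top_le_iff.1 (le_apply ⊤)
  have mixed : ∀ a b i j, i ∈ K → j ∉ K → a ∈ C i → b ∈ C j → γ a * γ b ≤ γ (a * b) := by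
    intro a b i j hi hj ha hb
    by_cases ha' : a = ⊤
    · rw [ha', apply_top, top_mul, top_mul]
    · rw [h.mul_left i j (hK i hi j hj) a ⟨ha, ha'⟩ b hb]
      exact mul_le_left _ _
  have upper : ∀ a b i j, i ≤ j → i ∉ K → j ∉ K → a ∈ C i → b ∈ C j → γ (a * b) = ⊤ := by
    intro a b i j hij hi hj ha hb
    by_cases ha' : a = ⊤
    · rw [ha', top_mul, hup j hj b hb]
    rcases hij.eq_or_lt with rfl | hlt
    · exact hup i hi _ ((h.hoop i).mul_mem a ha b hb)
    · rw [h.mul_left i j hlt a ⟨ha, ha'⟩ b hb, hup i hi a ha]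
  refine ⟨le_apply, fun a b hab => ?_, fun a => ?_, fun a b => ?_⟩
  · obtain ⟨i, hi⟩ := h.exists_mem a
    obtain ⟨j, hj⟩ := h.exists_mem b
    by_cases hjK : j ∈ K
    · by_cases hiK : i ∈ K
      · rwa [hlow i hiK a hi, hlow j hjK b hj]
      · by_cases hb : b = ⊤
        · rw [hb, apply_top]; exact le_top
        -- Here `b` lies in a lower component than `a`, so `a ≤ b` leaves only `a = b`.
        · rw [le_antisymm hab (h.le_of_lt (hK j hjK i hiK) hj hb hi)]
    · rw [hup j hjK b hj]; exact le_top
  · rcases cases a with h | h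
    · rw [h, h]
    · rw [h, apply_top]
  · obtain ⟨i, hi⟩ := h.exists_mem a
    obtain ⟨j, hj⟩ := h.exists_mem b
    by_cases hiK : i ∈ K <;> by_cases hjK : j ∈ K
    · rw [hlow i hiK a hi, hlow j hjK b hj]; exact le_apply _
    · exact mixed a b i j hiK hjK hi hj
    · rw [mul_comm, mul_comm a b]; exact mixed b a j i hjK hiK hj hi
    · rcases le_total i j with hij | hij
      · rw [upper a b i j hij hiK hjK hi hj]; exact le_top
      · rw [mul_comm a b, upper b a j i hij hjK hiK hj hi]; exact le_top

variable {m : ℕ}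

theorem sTerm_of_mem_bot (h : IsOrdinalSum C) {a : A} (ha : a ∈ C ⊥) :
    (UTerm.sTerm m).eval a = a := by
  rw [UTerm.eval_sTerm, h.neg_neg_of_mem_bot ha, inf_eq_left.2 (le_himp _ _)]

theorem sTerm_of_ne_bot (h : IsOrdinalSum C) {i : I} (hi : i ≠ ⊥) {a : A} (ha : a ∈ C i) :
    (UTerm.sTerm m).eval a = (a ^ m ⇨ a ^ (m + 1)) ⇨ a := by
  rw [UTerm.eval_sTerm, h.neg_neg_of_ne_bot hi ha, top_inf_eq]

theorem tTerm_of_mem_bot (h : IsOrdinalSum C) {a : A} (ha : a ∈ C ⊥) :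
    (UTerm.tTerm m).eval a = a := by
  rw [UTerm.eval_tTerm, h.neg_neg_of_mem_bot ha, inf_eq_left.2 (le_pow_himp_pow _ _)]

theorem tTerm_of_ne_bot (h : IsOrdinalSum C) {i : I} (hi : i ≠ ⊥) {a : A} (ha : a ∈ C i) :
    (UTerm.tTerm m).eval a = a ^ m ⇨ a ^ (m + 1) := by
  rw [UTerm.eval_tTerm, h.neg_neg_of_ne_bot hi ha, top_inf_eq]

theorem sTerm_of_pow_eq (h : IsOrdinalSum C) {i : I} (hi : i ≠ ⊥) {a : A} (ha : a ∈ C i)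
    (hm : a ^ m = a ^ (m + 1)) : (UTerm.sTerm m).eval a = a := by
  rw [h.sTerm_of_ne_bot hi ha, himp_eq_top.2 hm.le, top_himp]

theorem sTerm_of_mem_unboundedIdx (h : IsOrdinalSum C) {i : I} (hi : i ∈ unboundedIdx C) {a : A}
    (ha : a ∈ C i) : (UTerm.sTerm m).eval a = ⊤ := by
  rw [h.sTerm_of_ne_bot (h.ne_bot_of_mem_unboundedIdx hi) ha,
    (h.hoop i).pow_himp_pow_of_unbounded hi ha, himp_self]

theorem tTerm_of_pow_eq (h : IsOrdinalSum C) {i : I} (hi : i ≠ ⊥) {a : A} (ha : a ∈ C i)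
    (hm : a ^ m = a ^ (m + 1)) : (UTerm.tTerm m).eval a = ⊤ := by
  rw [h.tTerm_of_ne_bot hi ha, himp_eq_top.2 hm.le]

theorem tTerm_of_mem_unboundedIdx (h : IsOrdinalSum C) {i : I} (hi : i ∈ unboundedIdx C) {a : A}
    (ha : a ∈ C i) : (UTerm.tTerm m).eval a = a := by
  rw [h.tTerm_of_ne_bot (h.ne_bot_of_mem_unboundedIdx hi) ha,
    (h.hoop i).pow_himp_pow_of_unbounded hi ha]

theorem isNucleus_sTerm_iff (h : IsOrdinalSum C) (hm : 1 ≤ m) :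
    IsNucleus ((UTerm.sTerm m).eval : A → A) ↔
      (∀ i ∈ boundedIdx C \ {⊥}, ∀ j ∈ unboundedIdx C, i < j) ∧
      (∀ i ∈ boundedIdx C \ {⊥}, ∀ a ∈ C i, a ^ m = a ^ (m + 1)) := by
  constructor
  · intro hN
    have least : ∀ i ≠ ⊥, ∀ b ∈ C i, (∀ a ∈ C i, b ≤ a) → (UTerm.sTerm m).eval b = b := by
      intro i hi b hb hmin
      refine h.sTerm_of_pow_eq hi hb ?_
      -- The hypothesis `1 ≤ m` enters here: the zeroth power of `b` would be `⊤`, not `b`.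
      rw [(h.hoop i).pow_eq_self_of_least hb hmin (by lia),
        (h.hoop i).pow_eq_self_of_least hb hmin (by lia)]
    constructor
    · rintro i ⟨⟨b, hb, hmin⟩, hi⟩ j hj
      by_contra hij
      have hne : j ≠ i := by rintro rfl; exact hj ⟨b, hb, hmin⟩
      obtain ⟨x, hx, hx'⟩ := (h.hoop j).nontrivial
      have hxb := hN.monotone x b (h.le_of_lt (lt_of_le_of_ne (not_lt.1 hij) hne) hx hx' hb)
      rw [h.sTerm_of_mem_unboundedIdx hj hx, least i hi b hb hmin] at hxb
      exact (h.hoop i).ne_top_of_least hmin (top_le_iff.1 hxb)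
    · rintro i ⟨⟨b, hb, hmin⟩, hi⟩ a ha
      have hS := h.hoop i
      have hsa : (UTerm.sTerm m).eval a ≤ a := by
        -- By the Wajsberg identity `a = (a ⇨ b) ⇨ b`, so the bound follows from multiplicativity
        -- applied to `a * (a ⇨ b) = b`, which the term fixes.
        refine le_of_le_of_eq (le_himp_iff.2 ?_) (hS.himp_himp_of_le hb ha (hmin a ha))
        calc (UTerm.sTerm m).eval a * (a ⇨ b)
            ≤ (UTerm.sTerm m).eval a * (UTerm.sTerm m).eval (a ⇨ b) :=
              mul_le_mul_left (hN.le_apply _) _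
          _ ≤ (UTerm.sTerm m).eval (a * (a ⇨ b)) := hN.mul_le _ _
          _ = b := by rw [mul_himp_of_le (hmin a ha), least i hi b hb hmin]
      rw [h.sTerm_of_ne_bot hi ha] at hsa
      -- With `e = a^m ⇨ a^(m+1)`, the bound reads `e ⇨ a ≤ a`, so `e = (e ⇨ a) ⇨ a = ⊤`.
      have he := hS.himp_himp_of_le ha (hS.himp_mem _ (hS.pow_mem ha m) _ (hS.pow_mem ha (m + 1)))
        (le_pow_himp_pow a m)
      rw [himp_eq_top.2 hsa] at he
      exact le_antisymm (himp_eq_top.1 he.symm) (by rw [pow_succ]; exact mul_le_left _ _)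
  · rintro ⟨hlt, hpow⟩
    refine h.isNucleus_of_lower (boundedIdx C) (fun i hi j hj => ?_) (fun i hi a ha => ?_)
      fun i hi a ha => h.sTerm_of_mem_unboundedIdx hi ha
    · by_cases hi' : i = ⊥
      · rw [hi']; exact bot_lt_iff_ne_bot.2 (h.ne_bot_of_mem_unboundedIdx hj)
      · exact hlt i ⟨hi, hi'⟩ j hj
    · by_cases hi' : i = ⊥
      · exact h.sTerm_of_mem_bot (hi' ▸ ha)
      · exact h.sTerm_of_pow_eq hi' ha (hpow i ⟨hi, hi'⟩ a ha)

theorem isNucleus_tTerm_iff (h : IsOrdinalSum C) (hm : 1 ≤ m) :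
    IsNucleus ((UTerm.tTerm m).eval : A → A) ↔
      (∀ i ∈ unboundedIdx C, ∀ j ∈ boundedIdx C \ {⊥}, i < j) ∧
      (∀ i ∈ boundedIdx C \ {⊥}, ∀ a ∈ C i, a ^ m = a ^ (m + 1)) := by
  constructor
  · intro hN
    have top_of_le : ∀ i ≠ ⊥, ∀ b ∈ C i, (∀ a ∈ C i, b ≤ a) → ∀ a, b ≤ a →
        (UTerm.tTerm m).eval a = ⊤ := by
      intro i hi b hb hmin a hba
      rw [← top_le_iff, ← h.tTerm_of_pow_eq (m := m) hi hb]
      · exact hN.monotone b a hba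
      · rw [(h.hoop i).pow_eq_self_of_least hb hmin (by lia),
          (h.hoop i).pow_eq_self_of_least hb hmin (by lia)]
    constructor
    · rintro j hj i ⟨⟨b, hb, hmin⟩, hi⟩
      by_contra hij
      have hne : i ≠ j := by rintro rfl; exact hj ⟨b, hb, hmin⟩
      obtain ⟨x, hx, hx'⟩ := (h.hoop j).nontrivial
      have hbx := h.le_of_lt (lt_of_le_of_ne (not_lt.1 hij) hne) hb
        ((h.hoop i).ne_top_of_least hmin) hx
      have := top_of_le i hi b hb hmin x hbx
      rw [h.tTerm_of_mem_unboundedIdx hj hx] at this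
      exact hx' this
    · rintro i ⟨⟨b, hb, hmin⟩, hi⟩ a ha
      have := top_of_le i hi b hb hmin a (hmin a ha)
      rw [h.tTerm_of_ne_bot hi ha] at this
      exact le_antisymm (himp_eq_top.1 this) (by rw [pow_succ]; exact mul_le_left _ _)
  · rintro ⟨hlt, hpow⟩
    -- The first component is bounded, yet `t_m` is the identity on it, so its index must be added
    -- to the lower part.
    refine h.isNucleus_of_lower (insert ⊥ (unboundedIdx C)) ?_ ?_ ?_
    · intro i hi j hj
      obtain ⟨hj0, hjb⟩ := not_or.1 hj
      rcases hi with rfl | hi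
      · exact bot_lt_iff_ne_bot.2 hj0
      · exact hlt i hi j ⟨not_not.1 hjb, hj0⟩
    · rintro i (rfl | hi) a ha
      · exact h.tTerm_of_mem_bot ha
      · exact h.tTerm_of_mem_unboundedIdx hi ha
    · intro i hi a ha
      obtain ⟨hi0, hib⟩ := not_or.1 hi
      exact h.tTerm_of_pow_eq hi0 ha (hpow i ⟨not_not.1 hib, hi0⟩ a ha)

end IsOrdinalSum

end Components

/-- A criterion for nuclei on a variety, from a criterion for each ordinal sum. -/
theorem isNucleusOn_iff_of_isOrdinalSum {V : BLVariety.{u}} {t : UTerm}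
    {P : ∀ (A : Type u) [BLAlgebra A] (I : Type u) [LinearOrder I] [OrderBot I] (_ : I → Set A),
      Prop}
    (hP : ∀ (A : Type u) [BLAlgebra A] (I : Type u) [LinearOrder I] [OrderBot I] (C : I → Set A),
      IsOrdinalSum C → (IsNucleus (t.eval : A → A) ↔ P A I C)) :
    IsNucleusOn t V ↔ ∀ (A : Type u) [BLAlgebra A], V.Mem A → IsBLChain A →
      ∀ (I : Type u) [LinearOrder I] [OrderBot I] (C : I → Set A), IsOrdinalSum C → P A I C := by
  rw [isNucleusOn_iff_chain]
  refine ⟨fun h A _ hA hc I _ _ C hC => (hP A I C hC).1 (h A hA hc), fun h A _ hA hc => ?_⟩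
  -- A one-element algebra has no nontrivial component, hence no decomposition; every self-map of it
  -- is a nucleus.
  by_cases hn : (⊥ : A) = ⊤
  · have := subsingleton_of_bot_eq_top hn
    exact ⟨fun a => (Subsingleton.elim _ _).le, fun a b _ => (Subsingleton.elim _ _).le,
      fun a => Subsingleton.elim _ _, fun a b => (Subsingleton.elim _ _).le⟩
  · obtain ⟨I, _, _, C, hC⟩ := hc.exists_isOrdinalSum hn
    exact (hP A I C hC).2 (h A hA hc I C hC)

end BLNuclei

theorem mainTheorem3 (V : BLVariety.{u}) (m : ℕ) (hm : 1 ≤ m) :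
    (IsNucleusOn (UTerm.sTerm m) V ↔
      ∀ (A : Type u) [BLAlgebra A], V.Mem A → IsBLChain A →
        ∀ (I : Type u) [LinearOrder I] [OrderBot I] (C : I → Set A), IsOrdinalSum C →
          (∀ i ∈ boundedIdx C \ {⊥}, ∀ j ∈ unboundedIdx C, i < j) ∧
          (∀ i ∈ boundedIdx C \ {⊥}, ∀ a ∈ C i, a ^ m = a ^ (m + 1))) ∧
    (IsNucleusOn (UTerm.tTerm m) V ↔
      ∀ (A : Type u) [BLAlgebra A], V.Mem A → IsBLChain A →
        ∀ (I : Type u) [LinearOrder I] [OrderBot I] (C : I → Set A), IsOrdinalSum C →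
          (∀ i ∈ unboundedIdx C, ∀ j ∈ boundedIdx C \ {⊥}, i < j) ∧
          (∀ i ∈ boundedIdx C \ {⊥}, ∀ a ∈ C i, a ^ m = a ^ (m + 1))) := by
  exact ⟨isNucleusOn_iff_of_isOrdinalSum fun _ _ _ _ _ _ hC => hC.isNucleus_sTerm_iff hm,
    isNucleusOn_iff_of_isOrdinalSum fun _ _ _ _ _ _ hC => hC.isNucleus_tTerm_iff hm⟩
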